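/- **Conventions.** A paratopological group is a group with a $T_0$ topology for which multiplication is jointly continuous. For a paratopological group $G$, its group coreflection $G^\sharp$ is the same group with the topology induced by the map $x\mapsto(x,x^{-1})$ into $G\times G$; it is a Hausdorff topological group. The Raĭkov completion $\breve G$ of $G$ is the group completion $\varrho G^\sharp$ of $G^\sharp$ with respect to its two-sided uniformity, endowed with the topology in which the closures in $\varrho G^\sharp$ of the neighbourhoods of the identity of $G$ form a neighbourhood base at the identity, and neighbourhoods of other points are obtained by translation; $\breve G$ is a paratopological group that contains $G$ as a topological subgroup. Let $\mathcal C$ be a class of continuous homomorphisms between paratopological groups. A paratopological group $H$ is $\mathcal C$-complete if every homomorphism $h\colon X\to H$ in $\mathcal C$ has a unique extension to a continuous homomorphism $\breve X\to H$. The $\mathcal C$-completion $\mathcal C[G]$ of $G$ is the intersection of all $\mathcal C$-complete subgroups of $\breve G$ that contain $G$. A paratopological group $G$ is simply $sm$-factorizable if for every zero-set $A=f^{-1}(0)$ of a continuous function $f\colon G\to\mathbb R$ there are a continuous homomorphism $h\colon G\to H$ onto a separable metrizable paratopological group $H$ and a closed set $B\subseteq H$ with $A=h^{-1}[B]$. A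 space is pseudocompact if every continuous real-valued function on it is bounded. A subspace $X$ of a space $Y$ is $C$-embedded in $Y$ if every continuous real-valued function on $X$ extends to a continuous real-valued function on $Y$. **Proposition 3.5.** Let $\mathcal C$ be a subclass of the class of continuous homomorphisms from pseudocompact topological groups to paratopological groups. Then every regular simply $sm$-factorizable paratopological group $G$ is $C$-embedded in its $\mathcal C$-completion $\mathcal C[G]$. -/

import Mathlib

universe u v

section

open Filter Topology Uniformity UniformSpace Set
open scoped Pointwise

/-- A paratopological group: a group with a topology making the multiplication jointly continuous.
All paratopological groups are assumed to satisfy the `T₀` separation axiom. -/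
class ParatopologicalGroup (G : Type u) [Group G] [TopologicalSpace G] : Prop
    extends ContinuousMul G, T0Space G

/-- The group coreflection `G^♯` of `G`: the same group with the topology induced by
`x ↦ (x, x⁻¹)` from `G × G`. -/
def Sharp (G : Type u) : Type u := G

namespace Sharp
variable (G : Type u) [Group G]

instance instGroup : Group (Sharp G) := inferInstanceAs (Group G)

/-- The identity map `G^♯ → G`. -/
def down : Sharp G ≃* G := MulEquiv.refl G

variable [TopologicalSpace G]

instance instTopologicalSpace : TopologicalSpace (Sharp G) :=
  TopologicalSpace.induced (fun x => (down G x, (down G x)⁻¹)) inferInstance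

variable {G}

theorem isInducing : IsInducing fun x : Sharp G => (down G x, (down G x)⁻¹) := ⟨rfl⟩

theorem continuous_down : Continuous (down G) := continuous_fst.comp isInducing.continuous

theorem continuous_down_inv : Continuous (fun x => (down G x)⁻¹) :=
  continuous_snd.comp isInducing.continuous

theorem mem_nhds_one_iff {s : Set (Sharp G)} :
    s ∈ 𝓝 1 ↔ ∃ U ∈ 𝓝 (1 : G), ∀ x, down G x ∈ U → (down G x)⁻¹ ∈ U → x ∈ s := by
  rw [isInducing.nhds_eq_comap, map_one, inv_one, mem_comap]
  constructor
  · rintro ⟨t, ht, hts⟩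
    obtain ⟨U, hU, V, hV, h⟩ := mem_nhds_prod_iff.1 ht
    exact ⟨U ∩ V, inter_mem hU hV, fun x h1 h2 => hts (h ⟨h1.1, h2.2⟩)⟩
  · rintro ⟨U, hU, h⟩
    exact ⟨U ×ˢ U, prod_mem_nhds hU hU, fun x hx => h x hx.1 hx.2⟩

instance instIsTopologicalGroup [ContinuousMul G] : IsTopologicalGroup (Sharp G) where
  continuous_mul := by
    refine isInducing.continuous_iff.2 (Continuous.prodMk ?_ ?_)
    · exact ((continuous_down.comp continuous_fst).mul (continuous_down.comp continuous_snd)).congr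
        fun p => (map_mul _ _ _).symm
    · exact ((continuous_down_inv.comp continuous_snd).mul
        (continuous_down_inv.comp continuous_fst)).congr fun p => by simp
  continuous_inv := by
    refine isInducing.continuous_iff.2 (Continuous.prodMk ?_ ?_)
    · exact continuous_down_inv.congr fun p => by simp
    · exact continuous_down.congr fun p => by simp

instance instT0Space [T0Space G] : T0Space (Sharp G) :=
  t0Space_of_injective_of_continuous (down G).injective continuous_down
end Sharp

/-- A topological group regarded with its two-sided uniformity, the supremum of the left and the
right uniformities (in Mathlib's order on uniform structures this is `⊓`). -/
def TwoSided (H : Type u) : Type u := H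

namespace TwoSided
variable (H : Type u) [Group H] [TopologicalSpace H] [IsTopologicalGroup H]

instance instGroup : Group (TwoSided H) := inferInstanceAs (Group H)

instance instUniformSpace : UniformSpace (TwoSided H) :=
  (IsTopologicalGroup.leftUniformSpace H ⊓ IsTopologicalGroup.rightUniformSpace H).replaceTopology
    (inf_idem (‹TopologicalSpace H›)).symm

instance instIsTopologicalGroup : IsTopologicalGroup (TwoSided H) :=
  inferInstanceAs (IsTopologicalGroup H)

instance instT0Space [T0Space H] : T0Space (TwoSided H) := inferInstanceAs (T0Space H)

theorem uniformity_eq : 𝓤 (TwoSided H) =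
    comap (fun p : TwoSided H × TwoSided H => p.1⁻¹ * p.2) (𝓝 1) ⊓
      comap (fun p : TwoSided H × TwoSided H => p.2 * p.1⁻¹) (𝓝 1) := by
  rfl

variable {H}
theorem cauchy_iff' {F : Filter (TwoSided H)} : Cauchy F ↔ F.NeBot ∧ ∀ V ∈ 𝓝 (1 : TwoSided H),
    ∃ S ∈ F, ∀ x ∈ S, ∀ y ∈ S, x⁻¹ * y ∈ V ∧ y * x⁻¹ ∈ V := by
  rw [cauchy_iff]
  refine and_congr_right fun _ => ⟨fun h V hV => ?_, fun h s hs => ?_⟩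
  · obtain ⟨S, hS, h⟩ := h _ (by
      rw [uniformity_eq]
      exact inter_mem_inf (preimage_mem_comap hV) (preimage_mem_comap hV))
    exact ⟨S, hS, fun x hx y hy => h (mk_mem_prod hx hy)⟩
  · rw [uniformity_eq, mem_inf_iff] at hs
    obtain ⟨t, ⟨V, hV, hVt⟩, t', ⟨V', hV', hVt'⟩, rfl⟩ := hs
    obtain ⟨S, hS, h⟩ := h _ (inter_mem hV hV')
    exact ⟨S, hS, fun p hp => ⟨hVt (h _ hp.1 _ hp.2).1.1, hVt' (h _ hp.1 _ hp.2).2.2⟩⟩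

theorem cauchy_mul {F F' : Filter (TwoSided H)} (hF : Cauchy F) (hF' : Cauchy F') :
    Cauchy (map (fun p : TwoSided H × TwoSided H => p.1 * p.2) (F ×ˢ F')) := by
  rw [cauchy_iff'] at *
  obtain ⟨n, hF⟩ := hF
  obtain ⟨n', hF'⟩ := hF'
  refine ⟨inferInstance, fun V hV => ?_⟩
  obtain ⟨W, hW, hWV⟩ := exists_nhds_one_split4 hV
  have hW1 := mem_of_mem_nhds hW
  obtain ⟨S, hS, h⟩ := hF W hW
  obtain ⟨S', hS', h'⟩ := hF' W hW
  obtain ⟨x₀, hx₀⟩ := n.nonempty_of_mem hS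
  obtain ⟨y₀, hy₀⟩ := n'.nonempty_of_mem hS'
  have c1 : Tendsto (fun w : TwoSided H => y₀⁻¹ * w * y₀) (𝓝 1) (𝓝 1) :=
    Continuous.tendsto' (by fun_prop) _ _ (by simp)
  have c2 : Tendsto (fun w : TwoSided H => x₀ * w * x₀⁻¹) (𝓝 1) (𝓝 1) :=
    Continuous.tendsto' (by fun_prop) _ _ (by simp)
  obtain ⟨T, hT, k⟩ := hF _ (c1 hW)
  obtain ⟨T', hT', k'⟩ := hF' _ (c2 hW)
  refine ⟨_, image_mem_map (prod_mem_prod (inter_mem hS hT) (inter_mem hS' hT')), ?_⟩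
  rintro _ ⟨⟨x, y⟩, ⟨hx, hy⟩, rfl⟩ _ ⟨⟨x', y'⟩, ⟨hx', hy'⟩, rfl⟩
  constructor
  · have := hWV (h' _ hy.1 _ hy₀).1 (k _ hx.2 _ hx'.2).1 (h' _ hy₀ _ hy'.1).1 hW1
    simp only [mul_one] at this
    convert this using 1
    simp only []; group
  · have := hWV (h _ hx₀ _ hx'.1).2 (k' _ hy.2 _ hy'.2).2 (h _ hx.1 _ hx₀).2 hW1
    simp only [mul_one] at this
    convert this using 1
    simp only []; group

theorem uniformContinuous_inv : UniformContinuous (fun x : TwoSided H => x⁻¹) := by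
  rw [UniformContinuous, uniformity_eq, tendsto_inf, tendsto_comap_iff, tendsto_comap_iff]
  have key : Tendsto (fun x : TwoSided H => x⁻¹) (𝓝 1) (𝓝 1) := 
    Continuous.tendsto' continuous_inv _ _ (by simp)
  constructor
  · refine ((key.comp tendsto_comap).mono_left inf_le_right).congr fun p => ?_
    simp
  · refine ((key.comp tendsto_comap).mono_left inf_le_left).congr fun p => ?_
    simp
end TwoSided

/-- The Raikov completion of a topological group: the Hausdorff completion with respect to the
two-sided uniformity. The group operations extend those of `H` by continuity. -/
abbrev GroupCompletion (H : Type u) [Group H] [TopologicalSpace H] [IsTopologicalGroup H] : Type u :=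
  Completion (TwoSided H)

namespace GroupCompletion
variable {H : Type u} [Group H] [TopologicalSpace H] [IsTopologicalGroup H]

theorem isDenseInducing_prod : IsDenseInducing
    (Prod.map ((↑) : TwoSided H → GroupCompletion H) ((↑) : TwoSided H → GroupCompletion H)) :=
  Completion.isDenseInducing_coe.prodMap Completion.isDenseInducing_coe

noncomputable instance instMul : Mul (GroupCompletion H) :=
  ⟨fun a b => isDenseInducing_prod.extend
    (fun p : TwoSided H × TwoSided H => ((p.1 * p.2 : TwoSided H) : GroupCompletion H)) (a, b)⟩

noncomputable instance instInv : Inv (GroupCompletion H) :=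
  ⟨Completion.map (fun x : TwoSided H => x⁻¹)⟩

noncomputable instance instOne : One (GroupCompletion H) := ⟨((1 : TwoSided H) : GroupCompletion H)⟩

theorem exists_tendsto_mul (q : GroupCompletion H × GroupCompletion H) : ∃ c : GroupCompletion H,
    Tendsto (fun p : TwoSided H × TwoSided H => ((p.1 * p.2 : TwoSided H) : GroupCompletion H))
      (comap (Prod.map (↑) (↑)) (𝓝 q)) (𝓝 c) := by
  have hc (a : GroupCompletion H) : Cauchy (comap ((↑) : TwoSided H → GroupCompletion H) (𝓝 a)) :=
    have := Completion.isDenseInducing_coe.comap_nhds_neBot a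
    cauchy_nhds.comap' (Completion.isUniformInducing_coe _).comap_uniformity.le this
  have := ((TwoSided.cauchy_mul (hc q.1) (hc q.2)).map
    (Completion.uniformContinuous_coe (TwoSided H)))
  obtain ⟨c, hc⟩ := CompleteSpace.complete this
  refine ⟨c, ?_⟩
  rw [map_map, prod_comap_comap_eq, ← nhds_prod_eq] at hc
  exact hc

theorem continuous_mul' : Continuous fun p : GroupCompletion H × GroupCompletion H => p.1 * p.2 :=
  isDenseInducing_prod.continuous_extend exists_tendsto_mul

theorem coe_mul (x y : TwoSided H) :
    ((x * y : TwoSided H) : GroupCompletion H) = (x : GroupCompletion H) * y :=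
  (isDenseInducing_prod.extend_eq' exists_tendsto_mul (x, y)).symm

theorem coe_one : ((1 : TwoSided H) : GroupCompletion H) = 1 := rfl

theorem coe_inv (x : TwoSided H) : ((x⁻¹ : TwoSided H) : GroupCompletion H) = (x : GroupCompletion H)⁻¹ :=
  (Completion.map_coe TwoSided.uniformContinuous_inv x).symm

theorem continuous_inv' : Continuous fun a : GroupCompletion H => a⁻¹ := Completion.continuous_map

instance instContinuousMul : ContinuousMul (GroupCompletion H) := ⟨continuous_mul'⟩

noncomputable instance instGroup : Group (GroupCompletion H) where
  mul_assoc a b c := by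
    induction a, b, c using Completion.induction_on₃ with
    | hp => exact isClosed_eq (by fun_prop) (by fun_prop)
    | ih a b c => rw [← coe_mul, ← coe_mul, ← coe_mul, ← coe_mul, mul_assoc]
  one_mul a := by
    induction a using Completion.induction_on with
    | hp => exact isClosed_eq (by fun_prop) (by fun_prop)
    | ih a => rw [← coe_one, ← coe_mul, one_mul]
  mul_one a := by
    induction a using Completion.induction_on with
    | hp => exact isClosed_eq (by fun_prop) (by fun_prop)
    | ih a => rw [← coe_one, ← coe_mul, mul_one]
  inv_mul_cancel a := by
    induction a using Completion.induction_on with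
    | hp => exact isClosed_eq (continuous_inv'.mul continuous_id) (by fun_prop)
    | ih a => rw [← coe_inv, ← coe_mul, inv_mul_cancel, coe_one]

instance instIsTopologicalGroup : IsTopologicalGroup (GroupCompletion H) where
  continuous_inv := continuous_inv'

/-- The canonical homomorphism of a topological group to its Raikov completion. -/
noncomputable def of : H →* GroupCompletion H where
  toFun x := Completion.coe' (show TwoSided H from x)
  map_one' := rfl
  map_mul' x y := coe_mul (H := H) x y

theorem isDenseInducing_of : IsDenseInducing (of : H → GroupCompletion H) :=
  Completion.isDenseInducing_coe (α := TwoSided H)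

end GroupCompletion

/-- The Raikov completion `Ğ` of a paratopological group `G`. As a group it is the Raikov completion
of `G^♯`; a neighbourhood base at the identity is formed by the closures, in the Raikov completion
of `G^♯`, of the neighbourhoods of the identity in `G` (see `hasBasis_nhds_one`). Its uniqueness
properties are recorded below: `G` is a topological subgroup of `Ğ`, it is `♯`-dense in `Ğ`, and `Ğ`
is `♯`-complete. -/
def RaikovCompletion (G : Type u) [Group G] [TopologicalSpace G] [ParatopologicalGroup G] : Type u :=
  GroupCompletion (Sharp G)

namespace RaikovCompletion
variable (G : Type u) [Group G] [TopologicalSpace G] [ParatopologicalGroup G]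

noncomputable instance instGroup : Group (RaikovCompletion G) :=
  inferInstanceAs (Group (GroupCompletion (Sharp G)))

/-- The identity map from `Ğ` to the Raikov completion of `G^♯`. -/
noncomputable def toGroupCompletion : RaikovCompletion G ≃* GroupCompletion (Sharp G) :=
  MulEquiv.refl (GroupCompletion (Sharp G))

/-- The canonical homomorphism of `G` to the completion of `G^♯`. -/
noncomputable def ofAux : G →* GroupCompletion (Sharp G) :=
  GroupCompletion.of.comp (Sharp.down G).symm.toMonoidHom

/-- The filter generated by the closures, in the completion of `G^♯`, of the neighbourhoods of the
identity of `G`. -/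
noncomputable def nhdsOne : Filter (GroupCompletion (Sharp G)) :=
  (𝓝 (1 : G)).lift' fun U => closure (ofAux G '' U)

/-- The topology of `Ğ`, on the underlying group: the neighbourhoods of `x` are the left translates
by `x` of the members of `nhdsOne G` (see `nhds_auxTopology`). -/
@[reducible] noncomputable def auxTopology : TopologicalSpace (GroupCompletion (Sharp G)) :=
  TopologicalSpace.mkOfNhds fun x => map (fun y => x * y) (nhdsOne G)

noncomputable instance instTopologicalSpace : TopologicalSpace (RaikovCompletion G) :=
  (auxTopology G).induced (toGroupCompletion G)

/-- The canonical homomorphism `G → Ğ`. -/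
noncomputable def of : G →* RaikovCompletion G :=
  (toGroupCompletion G).symm.toMonoidHom.comp (ofAux G)

variable {G}

theorem hasBasis_nhdsOne :
    (nhdsOne G).HasBasis (fun U => U ∈ 𝓝 (1 : G)) fun U => closure (ofAux G '' U) :=
  (𝓝 (1 : G)).basis_sets.lift' fun _ _ h => closure_mono (image_mono h)

theorem isDenseInducing_ofAux :
    IsDenseInducing fun x : Sharp G => ofAux G (Sharp.down G x) :=
  GroupCompletion.isDenseInducing_of (H := Sharp G)

theorem nhds_one_le : 𝓝 1 ≤ nhdsOne G := by
  refine hasBasis_nhdsOne.ge_iff.2 fun U hU => ?_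
  have h : Sharp.down G ⁻¹' U ∈ 𝓝 (1 : Sharp G) :=
    Sharp.continuous_down.continuousAt.preimage_mem_nhds (by rwa [map_one])
  have := isDenseInducing_ofAux.closure_image_mem_nhds h
  rw [map_one, map_one] at this
  refine mem_of_superset this (closure_mono ?_)
  rintro _ ⟨x, hx, rfl⟩
  exact mem_image_of_mem _ hx

theorem closure_mul_mem {U V : Set G} {x y : GroupCompletion (Sharp G)}
    (hx : x ∈ closure (ofAux G '' U)) (hy : y ∈ closure (ofAux G '' V)) :
    x * y ∈ closure (ofAux G '' (U * V)) := by
  rw [image_mul]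
  exact map_mem_closure₂ continuous_mul hx hy fun a ha b hb => mul_mem_mul ha hb

theorem tendsto_mul : Tendsto (fun p : GroupCompletion (Sharp G) × GroupCompletion (Sharp G) =>
    p.1 * p.2) (nhdsOne G ×ˢ nhdsOne G) (nhdsOne G) := by
  refine ((hasBasis_nhdsOne.prod_self).tendsto_iff hasBasis_nhdsOne).2 fun U hU => ?_
  obtain ⟨V, hV, h⟩ := exists_nhds_one_split hU
  refine ⟨V, hV, fun p hp => closure_mono (image_mono ?_) (closure_mul_mem hp.1 hp.2)⟩
  exact mul_subset_iff.2 h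

theorem tendsto_conj (x : GroupCompletion (Sharp G)) :
    Tendsto (fun y => x * y * x⁻¹) (nhdsOne G) (nhdsOne G) := by
  refine (hasBasis_nhdsOne.tendsto_iff hasBasis_nhdsOne).2 fun U hU => ?_
  obtain ⟨W, hW, h⟩ := exists_nhds_one_split4 hU
  have hC := nhds_one_le (hasBasis_nhdsOne.mem_of_mem hW)
  have h1 : ∀ᶠ y in 𝓝 x, x * y⁻¹ ∈ closure (ofAux G '' W) ∧ y * x⁻¹ ∈ closure (ofAux G '' W) :=
    ((Continuous.tendsto' (by fun_prop) _ _ (by simp) :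
      Tendsto (fun y => x * y⁻¹) (𝓝 x) (𝓝 1)).eventually_mem hC).and
    ((Continuous.tendsto' (by fun_prop) _ _ (by simp) :
      Tendsto (fun y => y * x⁻¹) (𝓝 x) (𝓝 1)).eventually_mem hC)
  obtain ⟨_, ⟨a, rfl⟩, ha, ha'⟩ := isDenseInducing_ofAux.dense.inter_nhds_nonempty h1
  set b := Sharp.down G a
  have hV : (fun g => b * g * b⁻¹) ⁻¹' W ∈ 𝓝 (1 : G) :=
    (Continuous.tendsto' (by fun_prop) _ _ (by simp) :
      Tendsto (fun g => b * g * b⁻¹) (𝓝 1) (𝓝 1)) hW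
  refine ⟨_, hV, fun y hy => ?_⟩
  have hy' : ofAux G b * y * (ofAux G b)⁻¹ ∈ closure (ofAux G '' W) := by
    refine map_mem_closure (f := fun y => ofAux G b * y * (ofAux G b)⁻¹) (by fun_prop) hy ?_
    rintro _ ⟨g, hg, rfl⟩
    exact ⟨_, hg, by simp⟩
  have := closure_mul_mem (closure_mul_mem ha hy') ha'
  have e : x * (ofAux G b)⁻¹ * (ofAux G b * y * (ofAux G b)⁻¹) * (ofAux G b * x⁻¹) =
    x * y * x⁻¹ := by group
  rw [e] at this
  refine closure_mono (image_mono ?_) this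
  rintro _ ⟨_, ⟨p, hp, q, hq, rfl⟩, r, hr, rfl⟩
  simpa using h hp hq hr (mem_of_mem_nhds hW)

theorem eventually_mem_mul {z : GroupCompletion (Sharp G)} {U V : Set G}
    (hz : z ∈ closure (ofAux G '' U)) (hV : V ∈ 𝓝 (1 : G)) :
    ∀ᶠ w in 𝓝 z, ∀ g, ofAux G g = w → g ∈ U * V := by
  have hV' : Sharp.down G ⁻¹' V ∈ 𝓝 (1 : Sharp G) :=
    Sharp.continuous_down.continuousAt.preimage_mem_nhds (by rwa [map_one])
  rw [isDenseInducing_ofAux.isInducing.nhds_eq_comap, map_one, map_one] at hV'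
  obtain ⟨O, hO, h⟩ := hV'
  have : Tendsto (fun p : GroupCompletion (Sharp G) × GroupCompletion (Sharp G) => p.1⁻¹ * p.2)
    (𝓝 z ×ˢ 𝓝 z) (𝓝 1) := by
    rw [← nhds_prod_eq]
    exact Continuous.tendsto' (by fun_prop) _ _ (by simp)
  obtain ⟨A, hA, B, hB, hAB⟩ := mem_prod_iff.1 (this hO)
  obtain ⟨_, hu, u, huU, rfl⟩ := mem_closure_iff_nhds.1 hz A hA
  filter_upwards [hB]
  rintro _ hg g rfl
  have h1 : (ofAux G u)⁻¹ * ofAux G g ∈ O := hAB (mk_mem_prod hu hg)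
  have h2 : u⁻¹ * g ∈ V := @h ((Sharp.down G).symm (u⁻¹ * g)) (by simpa using h1)
  exact ⟨u, huU, _, h2, by simp⟩

theorem exists_closure_subset {O : Set (GroupCompletion (Sharp G))} (hO : O ∈ 𝓝 1) :
    ∃ U ∈ 𝓝 (1 : G), ∀ z, z ∈ closure (ofAux G '' U) → z⁻¹ ∈ closure (ofAux G '' U) → z ∈ O := by
  obtain ⟨C, hC, hCc, hCO⟩ := exists_mem_nhds_isClosed_subset hO
  have h1 : (fun x : Sharp G => ofAux G (Sharp.down G x)) ⁻¹' C ∈ 𝓝 1 := by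
    rw [isDenseInducing_ofAux.isInducing.nhds_eq_comap, map_one, map_one]
    exact preimage_mem_comap hC
  obtain ⟨W, hW, h⟩ := Sharp.mem_nhds_one_iff.1 h1
  obtain ⟨U, hU, hUW⟩ := exists_nhds_one_split hW
  refine ⟨U, hU, fun z hz hz' => hCO (hCc.closure_subset ?_)⟩
  have e1 := eventually_mem_mul hz hU
  have e2 := (continuous_inv.tendsto z).eventually (eventually_mem_mul hz' hU)
  refine mem_closure_iff_nhds.2 fun t ht => ?_
  obtain ⟨_, ⟨a, rfl⟩, ⟨k1, k2⟩, k3⟩ :=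
    isDenseInducing_ofAux.dense.inter_nhds_nonempty (inter_mem (inter_mem e1 e2) ht)
  refine ⟨_, k3, h a ?_ ?_⟩
  · exact mul_subset_iff.2 hUW (k1 _ rfl)
  · exact mul_subset_iff.2 hUW (k2 _ (map_inv _ _))

theorem nhds_auxTopology (x : GroupCompletion (Sharp G)) :
    @nhds _ (auxTopology G) x = map (fun y => x * y) (nhdsOne G) := by
  refine TopologicalSpace.nhds_mkOfNhds _ x ?_ ?_
  · intro a s hs
    have := mem_of_mem_nhds (nhds_one_le (mem_map.1 hs))
    simpa using this
  · intro a s hs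
    obtain ⟨t, ht, t', ht', h⟩ := mem_prod_iff.1 (tendsto_mul (mem_map.1 hs))
    refine mem_map.2 (mem_of_superset ht fun y hy => ?_)
    refine mem_map.2 (mem_of_superset ht' fun z hz => ?_)
    have : (y, z) ∈ t ×ˢ t' := ⟨hy, hz⟩
    simpa [mul_assoc] using h this

theorem nhds_one_auxTopology : @nhds _ (auxTopology G) 1 = nhdsOne G := by
  simp [nhds_auxTopology]

theorem nhds_one_eq : 𝓝 (1 : RaikovCompletion G) = comap (toGroupCompletion G) (nhdsOne G) := by
  rw [← nhds_one_auxTopology, ← map_one (toGroupCompletion G)]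
  exact @nhds_induced _ _ (auxTopology G) _ _

/-- Neighbourhood base of `Ğ` at the identity: the `♯`-closures of the neighbourhoods in `G`. -/
theorem hasBasis_nhds_one : (𝓝 (1 : RaikovCompletion G)).HasBasis (fun U => U ∈ 𝓝 (1 : G))
    fun U => toGroupCompletion G ⁻¹' closure (ofAux G '' U) := by
  rw [nhds_one_eq]
  exact hasBasis_nhdsOne.comap _

theorem continuousMul_auxTopology : @ContinuousMul _ (auxTopology G) _ := by
  refine @ContinuousMul.of_nhds_one _ _ (auxTopology G) ?_ (fun x => ?_) (fun x => ?_)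
  · rw [nhds_one_auxTopology]
    exact tendsto_mul
  · rw [nhds_one_auxTopology, nhds_auxTopology]
  · rw [nhds_one_auxTopology, nhds_auxTopology]
    refine le_antisymm ?_ ?_
    · refine le_trans (le_of_eq ?_) (map_mono (m := fun y => y * x) (tendsto_conj x))
      rw [map_map]
      congr 1
      funext y
      simp
    · refine le_trans (le_of_eq ?_) (map_mono (m := fun y => x * y) (tendsto_conj x⁻¹))
      rw [map_map]
      congr 1
      funext y
      simp [mul_assoc]

theorem t0Space_auxTopology : @T0Space _ (auxTopology G) := by
  refine @T0Space.mk _ (auxTopology G) fun x y hxy => ?_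
  have key : ∀ a b, @nhds _ (auxTopology G) a = @nhds _ (auxTopology G) b → ∀ U ∈ 𝓝 (1 : G),
      a⁻¹ * b ∈ closure (ofAux G '' U) := by
    intro a b hab U hU
    have : (fun y => a * y) '' (closure (ofAux G '' U)) ∈ @nhds _ (auxTopology G) b := by
      rw [← hab, nhds_auxTopology]
      exact image_mem_map (hasBasis_nhdsOne.mem_of_mem hU)
    obtain ⟨c, hc, rfl⟩ := @mem_of_mem_nhds _ (auxTopology G) _ _ this
    simpa using hc
  have h1 : x⁻¹ * y = 1 := by
    by_contra hne
    obtain ⟨U, hU, h⟩ := exists_closure_subset (isOpen_ne.mem_nhds (Ne.symm hne))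
    refine h _ (key x y hxy U hU) ?_ rfl
    simpa using key y x (Eq.symm hxy) U hU
  exact inv_mul_eq_one.1 h1

instance instParatopologicalGroup : ParatopologicalGroup (RaikovCompletion G) where
  toContinuousMul :=
    letI := auxTopology G
    haveI := continuousMul_auxTopology (G := G)
    continuousMul_induced (toGroupCompletion G)
  toT0Space :=
    letI := auxTopology G
    haveI := t0Space_auxTopology (G := G)
    t0Space_of_injective_of_continuous (toGroupCompletion G).injective continuous_induced_dom

theorem of_injective : Function.Injective (of G) :=
  (toGroupCompletion G).symm.injective.comp
    ((Completion.coe_injective (TwoSided (Sharp G))).comp (Sharp.down G).symm.injective)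

theorem nhds_one_eq_comap_of : 𝓝 (1 : G) = comap (of G) (𝓝 1) := by
  rw [nhds_one_eq, Filter.comap_comap]
  change 𝓝 (1 : G) = comap (ofAux G) (nhdsOne G)
  refine le_antisymm (tendsto_iff_comap.1 (hasBasis_nhdsOne.ge_iff.2 fun U hU => ?_)) ?_
  · exact mem_map.2 (mem_of_superset hU fun x hx => subset_closure (mem_image_of_mem (ofAux G) hx))
  · intro W hW
    obtain ⟨U, hU, hUW⟩ := exists_nhds_one_split hW
    refine ⟨_, hasBasis_nhdsOne.mem_of_mem hU, fun x hx => ?_⟩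
    exact mul_subset_iff.2 hUW ((eventually_mem_mul hx hU).self_of_nhds _ rfl)

/-- `G` is a topological subgroup of `Ğ`. -/
theorem isEmbedding_of : IsEmbedding (of G) := by
  have hn : ∀ {M : Type u} [Group M] [TopologicalSpace M] [ContinuousMul M] (x : M),
      𝓝 x = comap (fun y => x⁻¹ * y) (𝓝 1) := fun {M} _ _ _ x => by
    simpa [Homeomorph.mulLeft_symm] using ((Homeomorph.mulLeft x⁻¹).comap_nhds_eq 1).symm
  refine ⟨isInducing_iff_nhds.2 fun g => ?_, of_injective⟩
  rw [hn g, hn (of G g), nhds_one_eq_comap_of, Filter.comap_comap, Filter.comap_comap]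
  congr 1
  funext y
  simp

/-- The topology of `(Ğ)^♯` is that of the Raikov completion of `G^♯`. -/
theorem isInducing_sharp :
    IsInducing fun x : Sharp (RaikovCompletion G) => toGroupCompletion G (Sharp.down _ x) := by
  refine (IsTopologicalGroup.isInducing_iff_nhds_one (f := (toGroupCompletion G).toMonoidHom.comp
    (Sharp.down (RaikovCompletion G)).toMonoidHom)).2 ?_
  ext s
  rw [Sharp.mem_nhds_one_iff, mem_comap]
  constructor
  · rintro ⟨U, hU, h⟩
    obtain ⟨V, hV, hVU⟩ := hasBasis_nhds_one.mem_iff.1 hU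
    have hC := nhds_one_le (hasBasis_nhdsOne.mem_of_mem hV)
    refine ⟨_, inter_mem hC (inv_mem_nhds_one _ hC), fun x hx => h x (hVU hx.1) (hVU ?_)⟩
    simpa using hx.2
  · rintro ⟨O, hO, h⟩
    obtain ⟨U, hU, h'⟩ := exists_closure_subset hO
    refine ⟨_, hasBasis_nhds_one.mem_of_mem hU, fun x hx hx' => h (h' (toGroupCompletion G (Sharp.down _ x)) hx ?_)⟩
    rw [← map_inv]
    exact hx'

/-- `G` is `♯`-dense in `Ğ`. -/
theorem denseRange_sharp :
    DenseRange fun x : Sharp G => (Sharp.down _).symm (of G (Sharp.down G x)) := by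
  intro x
  rw [isInducing_sharp.closure_eq_preimage_closure_image, ← range_comp]
  exact isDenseInducing_ofAux.dense _

/-- `Ğ` is `♯`-complete. -/
instance completeSpace_sharp : CompleteSpace (TwoSided (Sharp (RaikovCompletion G))) := by
  let m : TwoSided (Sharp G) →* TwoSided (Sharp (RaikovCompletion G)) :=
    (Sharp.down _).symm.toMonoidHom.comp ((of G).comp (Sharp.down G).toMonoidHom)
  have hm' : IsInducing fun x : Sharp G => (Sharp.down _).symm (of G (Sharp.down G x)) :=
    isInducing_sharp.of_comp_iff.1 isDenseInducing_ofAux.isInducing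
  have hm : IsInducing m := hm'
  have h1 : 𝓝 1 = comap m (𝓝 1) := by rw [hm.nhds_eq_comap, map_one]
  have hu : IsUniformInducing m := by
    refine ⟨?_⟩
    simp only [TwoSided.uniformity_eq, h1, Filter.comap_inf, Filter.comap_comap]
    congr 2 <;> funext p <;> simp
  refine completeSpace_extension hu denseRange_sharp fun f hf => ?_
  obtain ⟨c, hc⟩ := CompleteSpace.complete (hf.map (Completion.uniformContinuous_coe _))
  refine ⟨(Sharp.down _).symm ((toGroupCompletion G).symm c), ?_⟩
  have hc' : map (fun x : Sharp (RaikovCompletion G) => toGroupCompletion G (Sharp.down _ x))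
      (map m f) ≤ 𝓝 c := hc
  exact (map_le_iff_le_comap.1 hc').trans_eq (isInducing_sharp.nhds_eq_comap
    ((Sharp.down _).symm ((toGroupCompletion G).symm c))).symm

end RaikovCompletion

instance Subgroup.instParatopologicalGroup {G : Type u} [Group G] [TopologicalSpace G]
    [ParatopologicalGroup G] (H : Subgroup G) : ParatopologicalGroup H where
  toContinuousMul := H.toSubmonoid.continuousMul

/-- A class of continuous homomorphisms between paratopological groups. -/
abbrev ParatopHomClass : Type (max (u + 1) (v + 1)) :=
  ∀ (X : Type v) (Y : Type u) [Group X] [TopologicalSpace X] [ParatopologicalGroup X]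
    [Group Y] [TopologicalSpace Y] [ParatopologicalGroup Y], Set (X →ₜ* Y)

/-- Every continuous real-valued function on `X` is bounded. -/
def IsPseudocompact (X : Type v) [TopologicalSpace X] : Prop :=
  ∀ f : C(X, ℝ), ∃ M : ℝ, ∀ x, |f x| ≤ M

/-- All members of `C` are homomorphisms from pseudocompact topological groups. -/
def ParatopHomClass.FromPseudocompactGroups (C : ParatopHomClass.{u, v}) : Prop :=
  ∀ (X : Type v) (Y : Type u) [Group X] [TopologicalSpace X] [ParatopologicalGroup X]
    [Group Y] [TopologicalSpace Y] [ParatopologicalGroup Y],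
    ∀ h ∈ C X Y, IsTopologicalGroup X ∧ IsPseudocompact X

/-- `G` is `C`-complete: every homomorphism `h : X → G` in the class `C` has a unique extension to a
continuous homomorphism `X̆ → G`. -/
def IsCComplete (C : ParatopHomClass.{u, v}) (G : Type u) [Group G] [TopologicalSpace G]
    [ParatopologicalGroup G] : Prop :=
  ∀ (X : Type v) [Group X] [TopologicalSpace X] [ParatopologicalGroup X],
    ∀ h ∈ C X G, ∃! k : RaikovCompletion X →ₜ* G, ∀ x, k (RaikovCompletion.of X x) = h x

/-- The `C`-completion `C[G]`: the intersection of all `C`-complete subgroups of `Ğ` containing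
`G`. -/
noncomputable def cCompletion (C : ParatopHomClass.{u, v}) (G : Type u) [Group G] [TopologicalSpace G]
    [ParatopologicalGroup G] : Subgroup (RaikovCompletion G) :=
  sInf {H | (RaikovCompletion.of G).range ≤ H ∧ IsCComplete C H}

/-- The inclusion `G → C[G]`. -/
noncomputable def toCCompletion (C : ParatopHomClass.{u, v}) (G : Type u) [Group G]
    [TopologicalSpace G] [ParatopologicalGroup G] : G →* cCompletion C G :=
  (RaikovCompletion.of G).codRestrict (cCompletion C G) fun x =>
    Subgroup.mem_sInf.2 fun _ hH => hH.1 ⟨x, rfl⟩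

/-- Functionally closed sets, or zero-sets. -/
def IsFunctionallyClosed {X : Type u} [TopologicalSpace X] (A : Set X) : Prop :=
  ∃ f : C(X, ℝ), A = f ⁻¹' {0}

/-- Simply `sm`-factorizable paratopological groups: every functionally closed subset is the
preimage of a closed set under a continuous homomorphism onto a separable metrizable
paratopological group. -/
def IsSimplySMFactorizable (G : Type u) [Group G] [TopologicalSpace G] : Prop :=
  ∀ A : Set G, IsFunctionallyClosed A →
    ∃ (H : Type u) (_ : Group H) (_ : TopologicalSpace H) (_ : ParatopologicalGroup H)
      (_ : TopologicalSpace.SeparableSpace H) (_ : TopologicalSpace.MetrizableSpace H)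
      (h : G →ₜ* H), Function.Surjective h ∧ ∃ B : Set H, IsClosed B ∧ A = h ⁻¹' B

/-- `X` is a subspace of `Y` through `i`, and is `C`-embedded in `Y`: each continuous real-valued
function on `X` has a continuous extension over `Y`. -/
def IsCEmbedding {X Y : Type u} [TopologicalSpace X] [TopologicalSpace Y] (i : X → Y) : Prop :=
  IsEmbedding i ∧ ∀ f : C(X, ℝ), ∃ F : C(Y, ℝ), ∀ x, F (i x) = f x

end

/-!
Let `S = RaikovCompletion.zeroSetClosure G` be the set of all `x ∈ Ğ` such that every zero-set of
the topological group `(Ğ)^♯` through `x` meets `G`. The argument rests on two properties of `S`.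

* `S` is a `C`-complete subgroup of `Ğ` that contains `G`, hence `C[G] ⊆ S`
  (`isCComplete_zeroSetClosure`). A homomorphism `X → S` from a pseudocompact topological group
  extends to `X̆ → Ğ`, as `(Ğ)^♯` is complete. If the extension left `S`, some continuous real
  function on `X̆` would have a zero but no zero in the dense subgroup `X`, and its inverse would be
  continuous and unbounded on `X`.

* Every continuous `f : G → ℝ` extends over `S` (`IsSimplySMFactorizable.exists_extension`). The
  zero-sets `{f ≤ q}` and `{q ≤ f}`, with `q` rational, are preimages of closed sets under one
  continuous homomorphism `h` from `G` to a metrizable paratopological group `H`. It extends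
  continuously to `Ğ → H̆`. The group `(H̆)^♯` is metrizable, so its points are zero-sets, and the
  extension maps `S` onto `h(G)`; since `f` factors through a continuous function on `h(G)`, it
  extends over `S`.
-/

open Filter Topology Uniformity UniformSpace Set

/-! ### Extending homomorphisms to completions -/

theorem TwoSided.uniformContinuous_of_continuous {A K : Type*} [Group A] [TopologicalSpace A]
    [IsTopologicalGroup A] [Group K] [TopologicalSpace K] [IsTopologicalGroup K] {f : A →* K}
    (hf : Continuous f) :
    UniformContinuous (α := TwoSided A) (β := TwoSided K) f := by
  let m : TwoSided A →* TwoSided K := f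
  have key : Tendsto m (𝓝 1) (𝓝 1) := Continuous.tendsto' hf _ _ (map_one m)
  change UniformContinuous m
  rw [UniformContinuous, TwoSided.uniformity_eq, TwoSided.uniformity_eq, tendsto_inf,
    tendsto_comap_iff, tendsto_comap_iff]
  constructor
  · refine ((key.comp tendsto_comap).mono_left inf_le_left).congr fun p => ?_
    simp
  · refine ((key.comp tendsto_comap).mono_left inf_le_right).congr fun p => ?_
    simp

theorem GroupCompletion.exists_extension {A K : Type*} [Group A] [TopologicalSpace A]
    [IsTopologicalGroup A] [Group K] [TopologicalSpace K] [IsTopologicalGroup K] [T0Space K]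
    [CompleteSpace (TwoSided K)] {f : A →* K} (hf : Continuous f) :
    ∃ k : GroupCompletion A →* K, Continuous k ∧ ∀ x, k (GroupCompletion.of x) = f x := by
  let m : TwoSided A → TwoSided K := f
  have hm : UniformContinuous m := TwoSided.uniformContinuous_of_continuous hf
  let k : GroupCompletion A → TwoSided K := Completion.extension m
  have hk : Continuous k := Completion.continuous_extension
  have hkc (x : TwoSided A) : k (x : Completion (TwoSided A)) = m x := Completion.extension_coe hm x
  refine ⟨MonoidHom.mk' k fun a b => ?_, hk, hkc⟩
  change k (a * b) = k a * k b
  induction a, b using Completion.induction_on₂ with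
  | hp => exact isClosed_eq (by fun_prop) (by fun_prop)
  | ih a b =>
    rw [← GroupCompletion.coe_mul, hkc, hkc, hkc]
    exact map_mul f a b

/-- A homomorphism from a topological group is continuous for the finer topology of the group
coreflection of its target. -/
theorem Sharp.continuous_of_isTopologicalGroup {A K : Type*} [Group A] [TopologicalSpace A]
    [IsTopologicalGroup A] [Group K] [TopologicalSpace K] (f : A →ₜ* K) :
    Continuous fun x => (Sharp.down K).symm (f x) := by
  refine Sharp.isInducing.continuous_iff.2 (Continuous.prodMk f.continuous_toFun ?_)
  exact (f.continuous_toFun.comp continuous_inv).congr fun x => map_inv f x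

theorem Sharp.continuous_map {A K : Type*} [Group A] [TopologicalSpace A]
    [Group K] [TopologicalSpace K] (f : A →ₜ* K) :
    Continuous fun x : Sharp A => (Sharp.down K).symm (f (Sharp.down A x)) := by
  refine Sharp.isInducing.continuous_iff.2
    (Continuous.prodMk (f.continuous_toFun.comp Sharp.continuous_down) ?_)
  exact (f.continuous_toFun.comp Sharp.continuous_down_inv).congr fun x => map_inv f _

namespace RaikovCompletion

/-- The extension is continuous for the `♯`-topologies only: in general it need not be continuous
for the original topologies. -/
theorem exists_sharp_extension {A K : Type*} [Group A] [TopologicalSpace A] [ParatopologicalGroup A]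
    [Group K] [TopologicalSpace K] [ParatopologicalGroup K] [CompleteSpace (TwoSided (Sharp K))]
    (f : A →ₜ* K) : ∃ k : RaikovCompletion A →* K,
      Continuous (fun x : Sharp (RaikovCompletion A) => (Sharp.down K).symm (k (Sharp.down _ x))) ∧
      ∀ x, k (of A x) = f x := by
  let m : Sharp A →* Sharp K :=
    (Sharp.down K).symm.toMonoidHom.comp (f.toMonoidHom.comp (Sharp.down A).toMonoidHom)
  have hm : Continuous m := Sharp.continuous_map f
  obtain ⟨k, hk, h⟩ := GroupCompletion.exists_extension hm
  exact ⟨(Sharp.down K).toMonoidHom.comp (k.comp (toGroupCompletion A).toMonoidHom),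
    hk.comp isInducing_sharp.continuous, fun x => h ((Sharp.down A).symm x)⟩

theorem denseRange_of (A : Type*) [Group A] [TopologicalSpace A] [ParatopologicalGroup A] :
    DenseRange (of A) :=
  (Sharp.down (RaikovCompletion A)).surjective.denseRange.comp (denseRange_sharp (G := A))
    Sharp.continuous_down

/-- The base of neighbourhoods of the identity in `Ă`, with the closures taken in `(Ă)^♯`. -/
theorem hasBasis_nhds_one_sharp (A : Type*) [Group A] [TopologicalSpace A]
    [ParatopologicalGroup A] :
    (𝓝 (1 : RaikovCompletion A)).HasBasis (fun U => U ∈ 𝓝 (1 : A))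
      fun U => (Sharp.down _).symm ⁻¹' closure ((fun x => (Sharp.down _).symm (of A x)) '' U) := by
  refine hasBasis_nhds_one.congr (fun _ => Iff.rfl) fun U _ => ?_
  rw [isInducing_sharp.closure_eq_preimage_closure_image, image_image]
  rfl

/-- The basic neighbourhoods of the identity in `B̆` are `♯`-closed, so a `♯`-continuous extension
into `B̆` of a continuous homomorphism is continuous. -/
theorem exists_map {A B : Type*} [Group A] [TopologicalSpace A] [ParatopologicalGroup A]
    [Group B] [TopologicalSpace B] [ParatopologicalGroup B] (f : A →ₜ* B) :
    ∃ k : RaikovCompletion A →ₜ* RaikovCompletion B,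
      Continuous (fun x : Sharp (RaikovCompletion A) =>
        (Sharp.down _).symm (k (Sharp.down _ x))) ∧
      ∀ x, k (of A x) = of B (f x) := by
  obtain ⟨k, hk, h⟩ := exists_sharp_extension (K := RaikovCompletion B)
    ⟨(of B).comp f.toMonoidHom, isEmbedding_of.continuous.comp f.continuous_toFun⟩
  refine ⟨⟨k, ?_⟩, hk, h⟩
  suffices key : Tendsto k (𝓝 1) (𝓝 1) by
    refine continuous_iff_continuousAt.2 fun x => ?_
    have h1 : Tendsto (fun y => k x * k (x⁻¹ * y)) (𝓝 x) (𝓝 (k x * 1)) :=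
      (key.comp (Continuous.tendsto' (by fun_prop) _ _ (by simp))).const_mul _
    simpa [ContinuousAt] using h1
  refine ((hasBasis_nhds_one_sharp A).tendsto_iff (hasBasis_nhds_one_sharp B)).2 fun U hU => ?_
  have hU' : f ⁻¹' U ∈ 𝓝 1 :=
    (Continuous.tendsto' f.continuous_toFun 1 1 (map_one f)).eventually_mem hU
  refine ⟨_, hU', fun x hx => ?_⟩
  rw [mem_preimage] at hx ⊢
  have hx' := fun t => map_mem_closure (t := t) hk hx
  refine hx' _ ?_
  rintro _ ⟨a, ha, rfl⟩
  exact ⟨f a, ha, congrArg (Sharp.down _).symm (h a).symm⟩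

instance isTopologicalGroup (A : Type*) [Group A] [TopologicalSpace A] [ParatopologicalGroup A]
    [IsTopologicalGroup A] : IsTopologicalGroup (RaikovCompletion A) := by
  have key : Tendsto (fun x : RaikovCompletion A => x⁻¹) (𝓝 1) (𝓝 1) := by
    refine ((hasBasis_nhds_one_sharp A).tendsto_iff (hasBasis_nhds_one_sharp A)).2 fun U hU => ?_
    refine ⟨_, inv_mem_nhds_one A hU, fun x hx => ?_⟩
    rw [mem_preimage] at hx ⊢
    have hc : Continuous fun y : Sharp (RaikovCompletion A) => y⁻¹ := continuous_inv
    rw [map_inv]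
    refine map_mem_closure hc hx ?_
    rintro _ ⟨a, ha, rfl⟩
    exact ⟨a⁻¹, ha, by simp⟩
  exact { continuous_inv := continuous_iff_continuousAt.2 fun x => by
            have h1 : Tendsto (fun y => (x⁻¹ * y)⁻¹ * x⁻¹) (𝓝 x) (𝓝 (1 * x⁻¹)) :=
              (key.comp (Continuous.tendsto' (by fun_prop) _ _ (by simp))).mul_const _
            simpa [ContinuousAt] using h1 }

/-- The completion of a first countable group is first countable, and a first countable `T₀`
topological group is metrizable. -/
theorem metrizableSpace_sharp (H : Type*) [Group H] [TopologicalSpace H] [ParatopologicalGroup H]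
    [FirstCountableTopology H] :
    TopologicalSpace.MetrizableSpace (Sharp (RaikovCompletion H)) := by
  have hd : IsDenseInducing fun x : Sharp H => (Sharp.down _).symm (of H (Sharp.down H x)) :=
    ⟨isInducing_sharp.of_comp_iff.1 isDenseInducing_ofAux.isInducing, denseRange_sharp⟩
  have h1 : (𝓝 (1 : Sharp H)).IsCountablyGenerated := by
    rw [Sharp.isInducing.nhds_eq_comap]
    infer_instance
  have h2 : (𝓝 (1 : Sharp (RaikovCompletion H))).IsCountablyGenerated := by
    obtain ⟨s, hs⟩ := (𝓝 (1 : Sharp H)).exists_antitone_basis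
    have := (hs.toHasBasis.hasBasis_of_isDenseInducing hd).isCountablyGenerated
    simpa using this
  have h3 : (𝓤 (TwoSided (Sharp (RaikovCompletion H)))).IsCountablyGenerated := by
    have : (𝓝 (1 : TwoSided (Sharp (RaikovCompletion H)))).IsCountablyGenerated := h2
    rw [TwoSided.uniformity_eq]
    infer_instance
  exact UniformSpace.metrizableSpace (X := TwoSided (Sharp (RaikovCompletion H)))

end RaikovCompletion

/-! ### The zero-set closure of `G` in its completion -/

namespace RaikovCompletion

/-- The subgroup of those `x ∈ Ğ` for which every zero-set of `(Ğ)^♯` through `x` meets `G`. Since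
`(Ğ)^♯` is completely regular, it is the `G_δ`-closure of `G` in `(Ğ)^♯`. -/
noncomputable def zeroSetClosure (G : Type u) [Group G] [TopologicalSpace G]
    [ParatopologicalGroup G] : Subgroup (RaikovCompletion G) where
  carrier := {x | ∀ φ : C(Sharp (RaikovCompletion G), ℝ), φ ((Sharp.down _).symm x) = 0 →
    ∃ g : G, φ ((Sharp.down _).symm (of G g)) = 0}
  one_mem' φ hφ := ⟨1, by rwa [map_one]⟩
  mul_mem' {x y} hx hy φ hφ := by
    obtain ⟨g, hg⟩ := hx (φ.comp ⟨fun z => z * (Sharp.down _).symm y, by fun_prop⟩)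
      (by simpa using hφ)
    obtain ⟨g', hg'⟩ := hy (φ.comp ⟨fun z => (Sharp.down _).symm (of G g) * z, by fun_prop⟩)
      (by simpa using hg)
    exact ⟨g * g', by simpa using hg'⟩
  inv_mem' {x} hx φ hφ := by
    obtain ⟨g, hg⟩ := hx (φ.comp ⟨fun z => z⁻¹, continuous_inv⟩) (by simpa using hφ)
    exact ⟨g⁻¹, by simpa using hg⟩

variable {G : Type u} [Group G] [TopologicalSpace G] [ParatopologicalGroup G]

theorem range_of_le_zeroSetClosure : (of G).range ≤ zeroSetClosure G := by
  rintro _ ⟨g, rfl⟩ φ hφ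
  exact ⟨g, hφ⟩

/-- A zero-set of `X̆` that misses the pseudocompact group `X` would give the unbounded function
`1 / φ` on `X`. Hence the extension of a homomorphism `X → zeroSetClosure G` over `X̆`, which exists
because `(Ğ)^♯` is complete, does not leave `zeroSetClosure G`. -/
theorem exists_extension_zeroSetClosure {X : Type v} [Group X] [TopologicalSpace X]
    [ParatopologicalGroup X] [IsTopologicalGroup X] (hX : IsPseudocompact X)
    (h : X →ₜ* zeroSetClosure G) :
    ∃ k : RaikovCompletion X →ₜ* zeroSetClosure G, ∀ x, k (of X x) = h x := by
  let i : X →ₜ* RaikovCompletion G :=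
    ⟨(zeroSetClosure G).subtype.comp h.toMonoidHom, continuous_subtype_val.comp h.continuous_toFun⟩
  obtain ⟨k, hk, hki⟩ := exists_sharp_extension i
  have hid := Sharp.continuous_of_isTopologicalGroup (ContinuousMonoidHom.id (RaikovCompletion X))
  have hk' : Continuous fun p => (Sharp.down _).symm (k p) := hk.comp hid
  have hi := Sharp.continuous_of_isTopologicalGroup i
  have hmem (p : RaikovCompletion X) : k p ∈ zeroSetClosure G := by
    intro φ hφ
    by_contra! hne
    have hne' (x : X) : φ ((Sharp.down _).symm (i x)) ≠ 0 := fun h0 => by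
      obtain ⟨g, hg⟩ := (h x).2 φ h0
      exact hne g hg
    obtain ⟨M, hM⟩ := hX ⟨fun x => (φ ((Sharp.down _).symm (i x)))⁻¹,
      (φ.continuous.comp hi).inv₀ hne'⟩
    have hcl : IsClosed {q : RaikovCompletion X | 1 ≤ M * |φ ((Sharp.down _).symm (k q))|} :=
      isClosed_le continuous_const (continuous_const.mul (φ.continuous.comp hk').abs)
    have hp : p ∈ {q : RaikovCompletion X | 1 ≤ M * |φ ((Sharp.down _).symm (k q))|} := by
      refine (denseRange_of X).induction_on p hcl fun x => ?_
      have h1 := hM x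
      have h2 := abs_pos.2 (hne' x)
      rw [mem_ofPred_eq, hki]
      rw [ContinuousMap.coe_mk, abs_inv, inv_le_iff_one_le_mul₀ h2] at h1
      exact h1
    rw [mem_ofPred_eq, hφ, abs_zero, mul_zero] at hp
    exact absurd hp (by norm_num)
  refine ⟨⟨k.codRestrict _ hmem, ?_⟩, fun x => Subtype.ext (hki x)⟩
  exact (Sharp.continuous_down.comp hk').subtype_mk hmem

/-- Continuous homomorphisms from `X̆` are determined by their restrictions to `X`, if `X` is a
topological group. The target need not be Hausdorff, but its group coreflection is. -/
theorem hom_ext {X : Type v} [Group X] [TopologicalSpace X]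
    [ParatopologicalGroup X] [IsTopologicalGroup X] {K : Type u} [Group K] [TopologicalSpace K]
    [ParatopologicalGroup K] {k k' : RaikovCompletion X →ₜ* K}
    (h : ∀ x, k (of X x) = k' (of X x)) : k = k' := by
  have := (denseRange_of X).equalizer (Sharp.continuous_of_isTopologicalGroup k)
    (Sharp.continuous_of_isTopologicalGroup k')
    (funext fun x => congrArg (Sharp.down K).symm (h x))
  exact DFunLike.ext _ _ fun p => (Sharp.down K).symm.injective (congrFun this p)

theorem isCComplete_zeroSetClosure {C : ParatopHomClass.{u, v}} (hC : C.FromPseudocompactGroups) :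
    IsCComplete C (zeroSetClosure G) := by
  intro X _ _ _ h hh
  obtain ⟨hX, hX'⟩ := hC X _ h hh
  obtain ⟨k, hk⟩ := exists_extension_zeroSetClosure hX' h
  exact ⟨k, hk, fun k' hk' => hom_ext fun x => (hk' x).trans (hk x).symm⟩

theorem cCompletion_le_zeroSetClosure {C : ParatopHomClass.{u, v}}
    (hC : C.FromPseudocompactGroups) : cCompletion C G ≤ zeroSetClosure G :=
  sInf_le ⟨range_of_le_zeroSetClosure, isCComplete_zeroSetClosure hC⟩

/-- Points of `(H̆)^♯` are zero-sets, so the extension over `Ğ` of a continuous homomorphism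
`h : G → H` maps `zeroSetClosure G` to `h(G)`. -/
theorem exists_continuous_lift {H : Type v} [Group H] [TopologicalSpace H]
    [ParatopologicalGroup H] [FirstCountableTopology H] (h : G →ₜ* H) :
    ∃ γ : zeroSetClosure G → G, Continuous (h ∘ γ) ∧
      ∀ (x : zeroSetClosure G) (g : G), (x : RaikovCompletion G) = of G g → h (γ x) = h g := by
  obtain ⟨k, hk, hkh⟩ := exists_map h
  have := metrizableSpace_sharp H
  let := TopologicalSpace.metrizableSpaceMetric (Sharp (RaikovCompletion H))
  have hex (x : zeroSetClosure G) : ∃ g : G, of H (h g) = k x := by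
    obtain ⟨g, hg⟩ := x.2 ⟨fun z => dist ((Sharp.down _).symm (k (Sharp.down _ z)))
      ((Sharp.down _).symm (k x)), hk.dist continuous_const⟩ (by simp)
    refine ⟨g, ?_⟩
    have h1 := (Sharp.down _).symm.injective (dist_eq_zero.1 hg)
    rw [← hkh, ← h1]
    simp
  choose γ hγ using hex
  refine ⟨γ, isEmbedding_of.continuous_iff.2 ?_, fun x g hx => of_injective ?_⟩
  · exact (k.continuous_toFun.comp continuous_subtype_val).congr fun x => (hγ x).symm
  · rw [hγ, hx, hkh]

end RaikovCompletion

/-! ### Factoring continuous functions -/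

/-- For a real-valued function it suffices to look at the countably many zero-sets `{f ≤ q}` and
`{q ≤ f}` with `q` rational; the countable product of the groups that serve them serves them all. -/
theorem IsSimplySMFactorizable.exists_hom {G : Type u} [Group G] [TopologicalSpace G]
    (hG : IsSimplySMFactorizable G) (f : C(G, ℝ)) :
    ∃ (H : Type u) (_ : Group H) (_ : TopologicalSpace H) (_ : ParatopologicalGroup H)
      (_ : FirstCountableTopology H) (h : G →ₜ* H),
      (∀ q : ℚ, ∃ B : Set H, IsClosed B ∧ f ⁻¹' Iic (q : ℝ) = h ⁻¹' B) ∧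
      (∀ q : ℚ, ∃ B : Set H, IsClosed B ∧ f ⁻¹' Ici (q : ℝ) = h ⁻¹' B) := by
  have hle (q : ℚ) : IsFunctionallyClosed (f ⁻¹' Iic (q : ℝ)) :=
    ⟨⟨fun x => max (f x - q) 0, by fun_prop⟩, by ext; simp⟩
  have hge (q : ℚ) : IsFunctionallyClosed (f ⁻¹' Ici (q : ℝ)) :=
    ⟨⟨fun x => max (q - f x) 0, by fun_prop⟩, by ext; simp⟩
  let A : ℚ ⊕ ℚ → Set G := Sum.elim (fun q => f ⁻¹' Iic (q : ℝ)) fun q => f ⁻¹' Ici (q : ℝ)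
  have hA (i) : IsFunctionallyClosed (A i) := by
    cases i
    exacts [hle _, hge _]
  choose H _ _ _ _ _ h _ B hB hAB using fun i => hG (A i) (hA i)
  have hp : ParatopologicalGroup (∀ i, H i) := { }
  let p : G →ₜ* ∀ i, H i :=
    ⟨MonoidHom.pi fun i => (h i).toMonoidHom, continuous_pi fun i => (h i).continuous_toFun⟩
  have key (i) : ∃ B : Set (∀ i, H i), IsClosed B ∧ A i = p ⁻¹' B :=
    ⟨_, (hB i).preimage (continuous_apply i), hAB i⟩
  exact ⟨∀ i, H i, inferInstance, inferInstance, hp, inferInstance, p,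
    fun q => key (.inl q), fun q => key (.inr q)⟩

theorem continuous_of_isClosed_preimage_rat {Y : Type*} [TopologicalSpace Y] {F : Y → ℝ}
    (hle : ∀ q : ℚ, IsClosed (F ⁻¹' Iic (q : ℝ))) (hge : ∀ q : ℚ, IsClosed (F ⁻¹' Ici (q : ℝ))) :
    Continuous F := by
  refine Real.isTopologicalBasis_Ioo_rat.continuous_iff.2 fun s hs => ?_
  simp only [mem_iUnion, mem_singleton_iff, exists_prop] at hs
  obtain ⟨a, b, -, rfl⟩ := hs
  rw [← Ioi_inter_Iio, ← compl_Iic, ← compl_Ici]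
  exact (hle a).isOpen_compl.inter (hge b).isOpen_compl

theorem IsSimplySMFactorizable.exists_extension {G : Type u} [Group G] [TopologicalSpace G]
    [ParatopologicalGroup G] (hG : IsSimplySMFactorizable G) (f : C(G, ℝ)) :
    ∃ F : C(RaikovCompletion.zeroSetClosure G, ℝ),
      ∀ (x : RaikovCompletion.zeroSetClosure G) (g : G),
        (x : RaikovCompletion G) = RaikovCompletion.of G g → F x = f g := by
  obtain ⟨H, _, _, _, _, h, hle, hge⟩ := hG.exists_hom f
  obtain ⟨γ, hγ, hγ'⟩ := RaikovCompletion.exists_continuous_lift h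
  refine ⟨⟨f ∘ γ, continuous_of_isClosed_preimage_rat (fun q => ?_) fun q => ?_⟩, fun x g hx => ?_⟩
  · obtain ⟨B, hB, hfB⟩ := hle q
    rw [preimage_comp, hfB]
    exact hB.preimage hγ
  · obtain ⟨B, hB, hfB⟩ := hge q
    rw [preimage_comp, hfB]
    exact hB.preimage hγ
  · -- `f` is constant on the fibres of `h`, as its rational sublevel sets are unions of fibres.
    have hq (q : ℚ) : f (γ x) ≤ q ↔ f g ≤ q := by
      obtain ⟨B, -, hfB⟩ := hle q
      have h1 (a : G) : f a ≤ q ↔ h a ∈ B := Set.ext_iff.1 hfB a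
      rw [h1, h1, hγ' x g hx]
    refine eq_of_forall_rat_lt_iff_lt fun q => ?_
    rw [← not_le, ← not_le]
    exact not_congr (hq q)

theorem proposition3p5 (C : ParatopHomClass.{u, v}) (hC : C.FromPseudocompactGroups)
    (G : Type u) [Group G] [TopologicalSpace G] [ParatopologicalGroup G] [RegularSpace G]
    (hG : IsSimplySMFactorizable G) : IsCEmbedding (toCCompletion C G) := by
  refine ⟨RaikovCompletion.isEmbedding_of.codRestrict _ fun x => (toCCompletion C G x).2,
    fun f => ?_⟩
  obtain ⟨F, hF⟩ := hG.exists_extension f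
  have hle := RaikovCompletion.cCompletion_le_zeroSetClosure (G := G) hC
  exact ⟨F.comp ⟨inclusion hle, continuous_inclusion hle⟩, fun x => hF _ _ rfl⟩
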